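/- Let $n\ge 0$ be an integer. For $a_0,\dots,a_n\in[0,1]$ and $p\in[0,1]$ put $$D(a_0,\dots,a_n;p)=\sum_{k=0}^n\binom nk p^k(1-p)^{n-k}\,|p-a_k| .$$ Let $\Omega$ be the set of all Borel probability measures on $[0,1]$, and for $\sigma_0,\dots,\sigma_n,\mu\in\Omega$ put $$E(\sigma_0,\dots,\sigma_n;\mu)=\int\cdots\int D(x_0,\dots,x_n;p)\,d\sigma_0(x_0)\cdots d\sigma_n(x_n)\,d\mu(p).$$ (This is the expected payoff of the two-player zero-sum game in which Player I draws $p$ from $\mu$, tosses $n$ times a coin with probability $p$ of heads, and tells Player II the number $k$ of heads; Player II then guesses a value $x_k$ drawn from $\sigma_k$ and pays $|p-x_k|$ to Player I.) Then $$\min_{\sigma_0,\dots,\sigma_n\in\Omega}\ \max_{\mu\in\Omega}\ E(\sigma_0,\dots,\sigma_n;\mu)=\max_{\mu\in\Omega}\ \min_{\sigma_0,\dots,\sigma_n\in\Omega}\ E(\sigma_0,\dots,\sigma_n;\mu),$$ where all four extrema (the inner ones for every choice of the outer variable) are attained. Moreover, the game has a mixed Nash equilibrium whose payoff is this common value: there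 are $\sigma_0^*,\dots,\sigma_n^*,\mu^*\in\Omega$ such that $E(\sigma_0^*,\dots,\sigma_n^*;\mu^*)$ equals it and $$E(\sigma_0^*,\dots,\sigma_n^*;\mu)\le E(\sigma_0^*,\dots,\sigma_n^*;\mu^*)\le E(\sigma_0,\dots,\sigma_n;\mu^*)\qquad\text{for all }\sigma_0,\dots,\sigma_n,\mu\in\Omega .$$ -/

import Mathlib

open MeasureTheory

/-- The penalty function: the expected absolute error `|p - a k|` when the coin has probability `p`
of heads, it is tossed `n` times, and the estimate `a k` is used after observing `k` heads. -/
noncomputable def penalty (n : ℕ) (a : Fin (n + 1) → ℝ) (p : ℝ) : ℝ :=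
  ∑ k : Fin (n + 1), (n.choose k : ℝ) * p ^ (k : ℕ) * (1 - p) ^ (n - (k : ℕ)) * |p - a k|

/-- The expected payoff `E(σ₀,…,σₙ;μ)` from Player II to Player I under mixed strategies: `p` has
law `μ`, and the estimates `x₀,…,xₙ` are drawn from the product measure `σ₀ ⊗ ⋯ ⊗ σₙ`. All of the
measures are Borel probability measures on `[0,1]`. -/
noncomputable def expectedPayoff (n : ℕ) (σ : Fin (n + 1) → ProbabilityMeasure unitInterval)
    (μ : ProbabilityMeasure unitInterval) : ℝ :=
  ∫ p : unitInterval, ∫ x : Fin (n + 1) → unitInterval,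
    penalty n (fun k => (x k : ℝ)) (p : ℝ)
      ∂(Measure.pi fun k => (σ k : Measure unitInterval)) ∂(μ : Measure unitInterval)

/-!
The penalty `D(a;p) = penalty n a p` is continuous in the coin `p` and convex and continuous in the guesses `a`, so by
Jensen's inequality Player II may replace a mixed strategy by the pure strategy that announces its
means (`exists_pureStrategy_le`). This leaves Player II with the convex compact set `[0,1]ⁿ⁺¹`.
Let `v` be the minimum over this set of the worst penalty `max_p D(a;p)`, attained at `a₀`; then
`a₀` keeps the payoff at most `v`.

That Player I can guarantee `v` by a single mixed strategy is a minimax theorem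
(`exists_probabilityMeasure_forall_le_integral`). For each `a` the set of laws `μ` whose payoff
against `a` is at least `v` is closed in the compact space of probability measures, so it suffices
to find a common `μ` for finitely many `aᵢ`. If there is none, the compact convex set of payoff
vectors `(∫ D(aᵢ;p) dμ(p))ᵢ` misses the orthant `[v,∞)ᵐ`, and a functional strictly separating the
two has nonnegative weights. The weighted mean of the `aᵢ` is then a guess against which, by
convexity, every coin yields less than `v`, contradicting the choice of `v`.
The saddle point so obtained (`exists_saddlePoint`) gives equality of the two values.
-/

open Set

/-! ### A minimax theorem for mixed strategies -/

/-- **Minimax theorem for mixed strategies**, one-sided form: if every `a ∈ s` admits some `y` with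
`v ≤ f a y`, and `f` is convex in `a` and continuous in `y`, then a single probability measure
guarantees `v` on average against all `a ∈ s` at once. -/
theorem exists_probabilityMeasure_forall_le_integral {E Y : Type*} [AddCommGroup E] [Module ℝ E]
    [TopologicalSpace Y] [CompactSpace Y] [T2Space Y] [Nonempty Y] [MeasurableSpace Y]
    [BorelSpace Y] {s : Set E} {f : E → Y → ℝ} {v : ℝ}
    (hconv : ∀ y, ConvexOn ℝ s fun a => f a y) (hcont : ∀ a ∈ s, Continuous (f a))
    (hv : ∀ a ∈ s, ∃ y, v ≤ f a y) :
    ∃ μ : ProbabilityMeasure Y, ∀ a ∈ s, v ≤ ∫ y, f a y ∂(μ : Measure Y) := by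
  have hint : ∀ a ∈ s, ∀ μ : Measure Y, IsFiniteMeasure μ → Integrable (f a) μ := fun a ha μ _ =>
    (BoundedContinuousFunction.mkOfCompact ⟨f a, hcont a ha⟩).integrable μ
  have hcontμ : ∀ a ∈ s, Continuous fun μ : ProbabilityMeasure Y =>
      ∫ y, f a y ∂(μ : Measure Y) := fun a ha =>
    ProbabilityMeasure.continuous_integral_boundedContinuousFunction
      (BoundedContinuousFunction.mkOfCompact ⟨f a, hcont a ha⟩)
  -- By compactness it suffices to treat finitely many `a` simultaneously.
  suffices hfin : ∀ t : Finset s, ∃ μ : ProbabilityMeasure Y,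
      ∀ a ∈ t, v ≤ ∫ y, f a y ∂(μ : Measure Y) by
    obtain ⟨μ, hμ⟩ := CompactSpace.iInter_nonempty
      (t := fun a : s => {μ : ProbabilityMeasure Y | v ≤ ∫ y, f a y ∂(μ : Measure Y)})
      (fun a => isClosed_le continuous_const (hcontμ a a.2))
      (fun t => by
        obtain ⟨μ, hμ⟩ := hfin t
        exact ⟨μ, mem_iInter₂.2 hμ⟩)
    exact ⟨μ, fun a ha => mem_iInter.1 hμ ⟨a, ha⟩⟩
  intro t
  let Φ : ProbabilityMeasure Y → t → ℝ := fun μ a => ∫ y, f a y ∂(μ : Measure Y)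
  have hΦ : Continuous Φ := continuous_pi fun a => hcontμ _ a.1.2
  by_contra! hno
  have hconvΦ : Convex ℝ (range Φ) := by
    rintro _ ⟨μ, rfl⟩ _ ⟨ν, rfl⟩ α β hα hβ hαβ
    refine ⟨⟨ENNReal.ofReal α • (μ : Measure Y) + ENNReal.ofReal β • (ν : Measure Y), ⟨?_⟩⟩, ?_⟩
    · simp [← ENNReal.ofReal_add hα hβ, hαβ]
    · ext a
      simp only [Φ, ProbabilityMeasure.coe_mk, Pi.add_apply, Pi.smul_apply, smul_eq_mul]
      rw [integral_add_measure ((hint _ a.1.2 _ inferInstance).smul_measure ENNReal.ofReal_ne_top)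
        ((hint _ a.1.2 _ inferInstance).smul_measure ENNReal.ofReal_ne_top)]
      simp [integral_smul_measure, hα, hβ]
  have hdisj : Disjoint (range Φ) (Ici fun _ => v) := by
    rw [Set.disjoint_left]
    rintro _ ⟨μ, rfl⟩ hμ
    obtain ⟨a, ha, hlt⟩ := hno μ
    exact absurd (hμ ⟨a, ha⟩) (not_le.2 hlt)
  obtain ⟨g, u, w, hgu, huw, hwg⟩ := geometric_hahn_banach_compact_closed hconvΦ
    (isCompact_range hΦ) (convex_Ici _) isClosed_Ici hdisj
  classical
  set l : t → ℝ := fun a => g (Pi.single a 1) with hl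
  have hg : ∀ z, g z = ∑ a, l a * z a := fun z => by
    conv_lhs => rw [← Finset.univ_sum_single z]
    rw [map_sum]
    refine Finset.sum_congr rfl fun a _ => ?_
    rw [hl, ← mul_one (z a), ← smul_eq_mul (z a) 1, Pi.single_smul, map_smul]
    simp [mul_comm]
  -- The separating functional is bounded below on an orthant, so its coefficients are nonnegative.
  have hl0 : ∀ a, 0 ≤ l a := fun a => by
    by_contra! hneg
    have hvw := hwg (fun _ => v) self_mem_Ici
    have hr : 0 ≤ (g (fun _ => v) - w) / (-l a) := div_nonneg (by linarith) (by linarith)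
    have := hwg ((fun _ => v) + ((g (fun _ => v) - w) / (-l a)) • Pi.single a 1) (by
      rw [mem_Ici, le_add_iff_nonneg_right]
      exact smul_nonneg hr (Pi.single_nonneg.2 zero_le_one))
    rw [map_add, map_smul, smul_eq_mul] at this
    have h2 : (g (fun _ => v) - w) / (-l a) * l a = -(g (fun _ => v) - w) := by
      rw [div_neg, neg_mul, div_mul_cancel₀ _ hneg.ne]
    change w < g (fun _ => v) + (g (fun _ => v) - w) / (-l a) * l a at this
    linarith
  obtain ⟨y₀⟩ := ‹Nonempty Y›
  have hL : 0 < ∑ a, l a := by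
    refine (Finset.sum_nonneg fun a _ => hl0 a).lt_of_ne fun h0 => ?_
    have hz : ∀ a, l a = 0 := fun a =>
      (Finset.sum_eq_zero_iff_of_nonneg fun a _ => hl0 a).1 h0.symm a (Finset.mem_univ a)
    have h1 := hgu _ ⟨diracProba y₀, rfl⟩
    have h2 := hwg (fun _ => v) self_mem_Ici
    simp only [hg, hz, zero_mul, Finset.sum_const_zero] at h1 h2
    linarith
  -- Some `y` is good against the barycentre of the `a`, hence by convexity on weighted average.
  obtain ⟨y, hy⟩ := hv (Finset.univ.centerMass l fun a : t => (a : E))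
    ((hconv y₀).1.centerMass_mem (fun a _ => hl0 a) hL fun a _ => a.1.2)
  have hJ := hy.trans ((hconv y).map_centerMass_le (fun a _ => hl0 a) hL fun a _ => a.1.2)
  have h1 := hgu _ ⟨diracProba y, rfl⟩
  have h2 := hwg (fun _ => v) self_mem_Ici
  rw [hg] at h1 h2
  rw [Finset.centerMass, smul_eq_mul, inv_mul_eq_div, le_div_iff₀ hL] at hJ
  simp only [Φ, diracProba, ProbabilityMeasure.coe_mk, integral_dirac] at h1
  rw [← Finset.sum_mul, mul_comm] at h2
  simp only [Function.comp_apply, smul_eq_mul] at hJ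
  linarith

/-! ### Optimal replies and the saddle point -/

theorem pi_dirac_eq_dirac {ι : Type*} [Fintype ι] {X : ι → Type*} [∀ i, MeasurableSpace (X i)]
    (a : ∀ i, X i) : Measure.pi (fun i => Measure.dirac (a i)) = Measure.dirac a := by
  classical
  refine Measure.pi_eq fun s hs => ?_
  rw [Measure.dirac_apply' _ (MeasurableSet.univ_pi hs)]
  simp_rw [Measure.dirac_apply' _ (hs _), Set.indicator_apply, Set.mem_univ_pi, Pi.one_apply]
  by_cases h : ∀ i, a i ∈ s i
  · simp [h]
  · obtain ⟨i, hi⟩ := not_forall.1 h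
    rw [if_neg h, eq_comm]
    exact Finset.prod_eq_zero (Finset.mem_univ i) (if_neg hi)

theorem continuous_penalty (n : ℕ) :
    Continuous fun q : (Fin (n + 1) → ℝ) × ℝ => penalty n q.1 q.2 := by
  unfold penalty
  fun_prop

theorem continuous_penalty_coin (n : ℕ) (a : Fin (n + 1) → ℝ) :
    Continuous fun p : unitInterval => penalty n a p :=
  (continuous_penalty n).comp (f := fun p : unitInterval => (a, (p : ℝ))) (by fun_prop)

theorem continuous_penalty_guess (n : ℕ) (p : ℝ) : Continuous fun a => penalty n a p :=
  (continuous_penalty n).comp (f := fun a => (a, p)) (by fun_prop)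

theorem convexOn_penalty (n : ℕ) (p : unitInterval) :
    ConvexOn ℝ univ fun a => penalty n a p := by
  refine ⟨convex_univ, fun a _ b _ α β hα hβ hαβ => ?_⟩
  simp only [penalty, smul_eq_mul, Finset.mul_sum, ← Finset.sum_add_distrib]
  refine Finset.sum_le_sum fun k _ => ?_
  have hw : 0 ≤ (n.choose k : ℝ) * (p : ℝ) ^ (k : ℕ) * (1 - (p : ℝ)) ^ (n - (k : ℕ)) :=
    mul_nonneg (mul_nonneg (Nat.cast_nonneg _) (pow_nonneg p.2.1 _))
      (pow_nonneg (sub_nonneg.2 p.2.2) _)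
  have habs : |(p : ℝ) - (α • a + β • b) k| ≤ α * |(p : ℝ) - a k| + β * |(p : ℝ) - b k| := by
    calc |(p : ℝ) - (α • a + β • b) k| = |α * (p - a k) + β * (p - b k)| := by
          congr 1
          simp only [Pi.add_apply, Pi.smul_apply, smul_eq_mul]
          linear_combination -(p : ℝ) * hαβ
      _ ≤ |α * (p - a k)| + |β * (p - b k)| := abs_add_le _ _
      _ = _ := by rw [abs_mul, abs_mul, abs_of_nonneg hα, abs_of_nonneg hβ]
  linarith [mul_le_mul_of_nonneg_left habs hw]

theorem continuous_integral_of_continuous_uncurry {X Y : Type*} [TopologicalSpace X]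
    [FirstCountableTopology X] [LocallyCompactSpace X] [TopologicalSpace Y] [CompactSpace Y]
    [MeasurableSpace Y] [OpensMeasurableSpace Y] (ν : Measure Y) [IsFiniteMeasure ν]
    {f : X → Y → ℝ} (hf : Continuous (Function.uncurry f)) :
    Continuous fun x => ∫ y, f x y ∂ν := by
  simpa using continuous_parametric_integral_of_continuous (μ := ν) hf isCompact_univ

theorem integrable_of_continuous {Y : Type*} [TopologicalSpace Y] [CompactSpace Y]
    [MeasurableSpace Y] [OpensMeasurableSpace Y] (ν : Measure Y) [IsFiniteMeasure ν]
    {f : Y → ℝ} (hf : Continuous f) : Integrable f ν :=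
  (BoundedContinuousFunction.mkOfCompact ⟨f, hf⟩).integrable ν

/-- The pure strategy of Player II which announces `a k` after `k` heads, as a mixed strategy. -/
noncomputable def pureStrategy {n : ℕ} (a : Fin (n + 1) → unitInterval) :
    Fin (n + 1) → ProbabilityMeasure unitInterval :=
  fun k => diracProba (a k)

theorem expectedPayoff_pureStrategy {n : ℕ} (a : Fin (n + 1) → unitInterval)
    (μ : ProbabilityMeasure unitInterval) :
    expectedPayoff n (pureStrategy a) μ =
      ∫ p : unitInterval, penalty n (fun k => (a k : ℝ)) p ∂(μ : Measure unitInterval) := by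
  simp only [expectedPayoff, pureStrategy, diracProba, ProbabilityMeasure.coe_mk,
    pi_dirac_eq_dirac, integral_dirac]

theorem continuous_integral_penalty {n : ℕ}
    (σ : Fin (n + 1) → ProbabilityMeasure unitInterval) :
    Continuous fun p : unitInterval => ∫ x : Fin (n + 1) → unitInterval,
      penalty n (fun k => (x k : ℝ)) (p : ℝ) ∂(Measure.pi fun k => (σ k : Measure unitInterval)) :=
  continuous_integral_of_continuous_uncurry _
    (f := fun (p : unitInterval) (x : Fin (n + 1) → unitInterval) =>
      penalty n (fun k => (x k : ℝ)) (p : ℝ))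
    ((continuous_penalty n).comp (f := fun q : unitInterval × (Fin (n + 1) → unitInterval) =>
      ((fun k => (q.2 k : ℝ)), (q.1 : ℝ))) (by fun_prop))

/-- Player II loses nothing by announcing the means of a mixed strategy: by Jensen's inequality,
since the penalty is convex in the announced values. -/
theorem exists_pureStrategy_le {n : ℕ} (σ : Fin (n + 1) → ProbabilityMeasure unitInterval) :
    ∃ a : Fin (n + 1) → unitInterval, ∀ μ : ProbabilityMeasure unitInterval,
      expectedPayoff n (pureStrategy a) μ ≤ expectedPayoff n σ μ := by
  set ν := Measure.pi fun k => (σ k : Measure unitInterval)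
  have hcoe : Continuous fun (x : Fin (n + 1) → unitInterval) k => (x k : ℝ) := by fun_prop
  have hint : Integrable (fun (x : Fin (n + 1) → unitInterval) k => (x k : ℝ)) ν :=
    (BoundedContinuousFunction.mkOfCompact ⟨_, hcoe⟩).integrable ν
  have hb : ∫ x, (fun k => (x k : ℝ)) ∂ν ∈ Icc (0 : Fin (n + 1) → ℝ) 1 :=
    (convex_Icc _ _).integral_mem isClosed_Icc
      (.of_forall fun x => ⟨fun k => (x k).2.1, fun k => (x k).2.2⟩) hint
  refine ⟨fun k => ⟨_, hb.1 k, hb.2 k⟩, fun μ => ?_⟩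
  rw [expectedPayoff_pureStrategy]
  refine integral_mono (integrable_of_continuous _ (continuous_penalty_coin n _))
    (integrable_of_continuous _ (continuous_integral_penalty σ)) fun p => ?_
  have hc := continuous_penalty_guess n p
  exact (convexOn_penalty n p).map_integral_le hc.continuousOn isClosed_univ
    (.of_forall fun _ => mem_univ _) hint (integrable_of_continuous _ (hc.comp hcoe))

/-- Against a fixed strategy of Player II, some coin is an optimal reply of Player I. -/
theorem exists_forall_expectedPayoff_le {n : ℕ}
    (σ : Fin (n + 1) → ProbabilityMeasure unitInterval) :
    ∃ p₀ : unitInterval, ∀ μ : ProbabilityMeasure unitInterval,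
      expectedPayoff n σ μ ≤ expectedPayoff n σ (diracProba p₀) := by
  have hc := continuous_integral_penalty σ
  obtain ⟨p₀, -, hp₀⟩ := isCompact_univ.exists_isMaxOn univ_nonempty hc.continuousOn
  refine ⟨p₀, fun μ => ?_⟩
  simp only [expectedPayoff, diracProba, ProbabilityMeasure.coe_mk, integral_dirac]
  refine (integral_mono (integrable_of_continuous _ hc) (integrable_const _)
    fun p => hp₀ (mem_univ p)).trans_eq ?_
  simp

/-- Against a fixed strategy of Player I, some pure strategy is an optimal reply of Player II. -/
theorem exists_forall_le_expectedPayoff {n : ℕ} (μ : ProbabilityMeasure unitInterval) :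
    ∃ a : Fin (n + 1) → unitInterval, ∀ σ : Fin (n + 1) → ProbabilityMeasure unitInterval,
      expectedPayoff n (pureStrategy a) μ ≤ expectedPayoff n σ μ := by
  have hc : Continuous fun a : Fin (n + 1) → unitInterval =>
      expectedPayoff n (pureStrategy a) μ := by
    simp only [expectedPayoff_pureStrategy]
    exact continuous_integral_of_continuous_uncurry _
      (f := fun (x : Fin (n + 1) → unitInterval) (p : unitInterval) =>
        penalty n (fun k => (x k : ℝ)) (p : ℝ))
      ((continuous_penalty n).comp (f := fun q : (Fin (n + 1) → unitInterval) × unitInterval =>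
        ((fun k => (q.1 k : ℝ)), (q.2 : ℝ))) (by fun_prop))
  obtain ⟨a, -, ha⟩ := isCompact_univ.exists_isMinOn univ_nonempty hc.continuousOn
  refine ⟨a, fun σ => ?_⟩
  obtain ⟨b, hb⟩ := exists_pureStrategy_le σ
  exact (ha (mem_univ b)).trans (hb μ)

/-- A saddle point, with Player II playing a pure strategy. Its payoff `v` is taken to be the
minimum over `a ∈ [0,1]ⁿ⁺¹` of the worst penalty over `p`. -/
theorem exists_saddlePoint (n : ℕ) :
    ∃ (a₀ : Fin (n + 1) → unitInterval) (μ₀ : ProbabilityMeasure unitInterval) (v : ℝ),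
      (∀ μ, expectedPayoff n (pureStrategy a₀) μ ≤ v) ∧ ∀ σ, v ≤ expectedPayoff n σ μ₀ := by
  set K : Set (Fin (n + 1) → ℝ) := Icc 0 1
  have hp := continuous_penalty_coin n
  have hlsc : LowerSemicontinuousOn (fun a => ⨆ p : unitInterval, penalty n a p) K := by
    refine lowerSemicontinuousOn_ciSup (fun a _ => (isCompact_range (hp a)).bddAbove) fun p => ?_
    exact (continuous_penalty_guess n p).lowerSemicontinuous.lowerSemicontinuousOn _
  obtain ⟨a₀, ha₀, hmin⟩ := hlsc.exists_isMinOn (nonempty_Icc.2 zero_le_one) isCompact_Icc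
  obtain ⟨μ₀, hμ₀⟩ := exists_probabilityMeasure_forall_le_integral (s := K)
    (f := fun a (p : unitInterval) => penalty n a p) (v := ⨆ p : unitInterval, penalty n a₀ p)
    (fun p => (convexOn_penalty n p).subset (subset_univ _) (convex_Icc _ _)) (fun a _ => hp a)
    fun a ha => by
      obtain ⟨p, hpm⟩ := (isCompact_range (hp a)).sSup_mem (range_nonempty _)
      exact ⟨p, (hmin ha).trans_eq hpm.symm⟩
  refine ⟨fun k => ⟨a₀ k, ha₀.1 k, ha₀.2 k⟩, μ₀, ⨆ p : unitInterval, penalty n a₀ p,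
    fun μ => ?_, fun σ => ?_⟩
  · rw [expectedPayoff_pureStrategy]
    refine (integral_mono (integrable_of_continuous _ (hp a₀)) (integrable_const _)
      fun p => le_ciSup (isCompact_range (hp a₀)).bddAbove p).trans_eq ?_
    simp
  · obtain ⟨b, hb⟩ := exists_pureStrategy_le σ
    refine le_trans ?_ (hb μ₀)
    rw [expectedPayoff_pureStrategy]
    exact hμ₀ _ ⟨fun k => (b k).2.1, fun k => (b k).2.2⟩

/-- `maxE σ` is the attained maximum of the payoff over `μ`, `minE μ` is the attained minimum of
the payoff over `σ`; the attained minimum of `maxE` and the attained maximum of `minE` are the same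
number `v`, and a saddle point (mixed Nash equilibrium) exists, with payoff `v`. -/
theorem theorem4p1 (n : ℕ) :
    ∃ (maxE : (Fin (n + 1) → ProbabilityMeasure unitInterval) → ℝ)
      (minE : ProbabilityMeasure unitInterval → ℝ) (v : ℝ),
      (∀ σ : Fin (n + 1) → ProbabilityMeasure unitInterval,
        IsGreatest (Set.range fun μ : ProbabilityMeasure unitInterval => expectedPayoff n σ μ)
          (maxE σ)) ∧
      (∀ μ : ProbabilityMeasure unitInterval,
        IsLeast (Set.range fun σ : Fin (n + 1) → ProbabilityMeasure unitInterval =>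
          expectedPayoff n σ μ) (minE μ)) ∧
      IsLeast (Set.range maxE) v ∧
      IsGreatest (Set.range minE) v ∧
      ∃ (σ₀ : Fin (n + 1) → ProbabilityMeasure unitInterval)
        (μ₀ : ProbabilityMeasure unitInterval),
        expectedPayoff n σ₀ μ₀ = v ∧
        (∀ μ : ProbabilityMeasure unitInterval,
          expectedPayoff n σ₀ μ ≤ expectedPayoff n σ₀ μ₀) ∧
        (∀ σ : Fin (n + 1) → ProbabilityMeasure unitInterval,
          expectedPayoff n σ₀ μ₀ ≤ expectedPayoff n σ μ₀) := by
  choose p hp using exists_forall_expectedPayoff_le (n := n)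
  choose a ha using exists_forall_le_expectedPayoff (n := n)
  obtain ⟨a₀, μ₀, v, hI, hII⟩ := exists_saddlePoint n
  have hv : expectedPayoff n (pureStrategy a₀) μ₀ = v := (hI μ₀).antisymm (hII _)
  refine ⟨fun σ => expectedPayoff n σ (diracProba (p σ)),
    fun μ => expectedPayoff n (pureStrategy (a μ)) μ, v,
    fun σ => ⟨⟨_, rfl⟩, ?_⟩, fun μ => ⟨⟨_, rfl⟩, ?_⟩, ⟨⟨pureStrategy a₀, ?_⟩, ?_⟩, ⟨⟨μ₀, ?_⟩, ?_⟩,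
    pureStrategy a₀, μ₀, hv, fun μ => (hI μ).trans_eq hv.symm, fun σ => hv.trans_le (hII σ)⟩
  · rintro _ ⟨μ, rfl⟩
    exact hp σ μ
  · rintro _ ⟨σ, rfl⟩
    exact ha μ σ
  · exact (hI _).antisymm (hv.symm.trans_le (hp _ μ₀))
  · rintro _ ⟨σ, rfl⟩
    exact (hII σ).trans (hp σ μ₀)
  · exact ((ha μ₀ _).trans_eq hv).antisymm (hII _)
  · rintro _ ⟨μ, rfl⟩
    exact (ha μ _).trans (hI μ)
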